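/- Consider the following two decision problems. \textbf{Two-Hamiltonian-dicycle decomposition.} Given a (nonempty) Eulerian digraph $G$ in which every node has in-degree $2$ and out-degree $2$ (loops and parallel arcs allowed), can the arc set of $G$ be partitioned into two Hamiltonian dicycles? \textbf{SCM-Circ-Dist.} Given a rational polyhedron $P=\{z\in\mathbb{R}^n : Az=b,\ Bz\le d\}$ (by rational $A,b,B,d$), two vertices $x,y$ of $P$, and $k\in\mathbb{N}$, is there a list $W=((g_1,\lambda_1),\dots,(g_r,\lambda_r))$ with $r\le k$ that is both a circuit walk from $x$ to $y$ and a sign-compatible circuit decomposition of $y-x$ with respect to $B$? Here the circuits of $P$ are the vectors $g\in\ker(A)\setminus\{0\}$ with coprime integral components for which $Bg$ is support-minimal in $\{Bz : z\in\ker(A)\setminus\{0\}\}$. The list $W$ is a circuit walk from $x$ to $y$ if each $g_i$ is a circuit, each $\lambda_i>0$, $x+\sum_{i=1}^r\lambda_i g_i=y$, $x+\sum_{i=1}^{j}\lambda_i g_i\in P$ for all $1\le j\le r$, and each step is maximal: $x+\sum_{i=1}^{j-1}\lambda_i g_i+\lambda g_j\notin P$ for all $1\le j\le r$ and $\lambda>\lambda_j$.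 It is a sign-compatible circuit decomposition of $y-x$ with respect to $B$ if each $g_i$ is a circuit, each $\lambda_i>0$, $\sum_{i=1}^r\lambda_i g_i=y-x$, and $(Bg_i)(l)\cdot(Bg_j)(l)\ge 0$ for all $i,j$ and every row index $l$ of $B$. Then SCM-Circ-Dist is at least as hard as the two-Hamiltonian-dicycle decomposition problem: there is a polynomial-time many-one reduction from the latter to the former, that is, a map $f$, computable by a Turing machine in time polynomial in the length of the input, that sends each digraph $G$ as above to an instance of SCM-Circ-Dist such that $G$ can be decomposed into two Hamiltonian dicycles if and only if $f(G)$ is a yes-instance. -/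

import Mathlib

/-! ### Polyhedra, circuits and circuit walks -/

section Polyhedra

variable {κ μ ι : Type*} [Fintype ι]

/-- The polyhedron `{x | A x = b, B x ≤ d}` in real space. -/
def polyhedron (A : Matrix κ ι ℝ) (b : κ → ℝ) (B : Matrix μ ι ℝ) (d : μ → ℝ) : Set (ι → ℝ) :=
  {x | A.mulVec x = b ∧ B.mulVec x ≤ d}

/-- The set of circuits `𝒞(A, B)`: the nonzero vectors `g` of `ker A` for which `B g` has minimal
support among all `B z` with `z ∈ ker A \ {0}`, normalized to coprime integral components. -/
def circuits (A : Matrix κ ι ℝ) (B : Matrix μ ι ℝ) : Set (ι → ℝ) :=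
  {g | A.mulVec g = 0 ∧ g ≠ 0 ∧
    (∀ z : ι → ℝ, A.mulVec z = 0 → z ≠ 0 →
      Function.support (B.mulVec z) ⊆ Function.support (B.mulVec g) →
      Function.support (B.mulVec z) = Function.support (B.mulVec g)) ∧
    ∃ c : ι → ℤ, (∀ i, g i = (c i : ℝ)) ∧ Finset.univ.gcd c = 1}

/-- The point reached from `x` after the first `k` steps `(g, t)` of the list `W`. -/
def walkPoint (x : ι → ℝ) (W : List ((ι → ℝ) × ℝ)) (k : ℕ) : ι → ℝ :=
  x + ((W.take k).map fun s => s.2 • s.1).sum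

/-- `W` is a (maximal) circuit walk from `x` to `y` in the polyhedron given by `A, b, B, d`. -/
structure IsCircuitWalk (A : Matrix κ ι ℝ) (b : κ → ℝ) (B : Matrix μ ι ℝ) (d : μ → ℝ)
    (x y : ι → ℝ) (W : List ((ι → ℝ) × ℝ)) : Prop where
  circuit_direction : ∀ s ∈ W, s.1 ∈ circuits A B
  positive_step : ∀ s ∈ W, 0 < s.2
  reachability : walkPoint x W W.length = y
  feasibility : ∀ k, 1 ≤ k → k ≤ W.length → walkPoint x W k ∈ polyhedron A b B d
  maximality : ∀ (k : ℕ) (hk : k < W.length) (t : ℝ), (W[k]).2 < t →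
    walkPoint x W k + t • (W[k]).1 ∉ polyhedron A b B d

/-- Two vectors are sign-compatible with respect to `B`. -/
def SignCompatible (B : Matrix μ ι ℝ) (u v : ι → ℝ) : Prop :=
  ∀ i, 0 ≤ B.mulVec u i * B.mulVec v i

/-- `W` is a sign-compatible circuit decomposition of `u` with respect to `B`, that is, it writes
`u` as a conformal sum of circuits. -/
structure IsSignCompatibleDecomposition (A : Matrix κ ι ℝ) (B : Matrix μ ι ℝ)
    (u : ι → ℝ) (W : List ((ι → ℝ) × ℝ)) : Prop where
  circuit : ∀ s ∈ W, s.1 ∈ circuits A B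
  positive : ∀ s ∈ W, 0 < s.2
  sum_eq : (W.map fun s => s.2 • s.1).sum = u
  compatible : ∀ s ∈ W, ∀ s' ∈ W, SignCompatible B s.1 s'.1

end Polyhedra

/-! ### The problem SCM-Circ-Dist -/

/-- An instance of SCM-Circ-Dist: a rational polyhedron `P = {z | A z = b, B z ≤ d}`, two vertices
`x`, `y` of `P`, and a number `k`. -/
structure SCMCircDistInstance where
  /-- the dimension of the ambient space -/
  dim : ℕ
  /-- the number of equations -/
  numEq : ℕ
  /-- the number of inequalities -/
  numIneq : ℕ
  A : Matrix (Fin numEq) (Fin dim) ℚ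
  b : Fin numEq → ℚ
  B : Matrix (Fin numIneq) (Fin dim) ℚ
  d : Fin numIneq → ℚ
  x : Fin dim → ℚ
  y : Fin dim → ℚ
  k : ℕ
  x_vertex : (fun i => (x i : ℝ)) ∈ Set.extremePoints ℝ
    (polyhedron (A.map fun q => (q : ℝ)) (fun i => (b i : ℝ))
      (B.map fun q => (q : ℝ)) (fun i => (d i : ℝ)))
  y_vertex : (fun i => (y i : ℝ)) ∈ Set.extremePoints ℝ
    (polyhedron (A.map fun q => (q : ℝ)) (fun i => (b i : ℝ))
      (B.map fun q => (q : ℝ)) (fun i => (d i : ℝ)))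

/-- The question of SCM-Circ-Dist: is there a circuit walk from `x` to `y` with at most `k` steps
that is also a sign-compatible circuit decomposition of `y - x`? -/
def SCMCircDist (I : SCMCircDistInstance) : Prop :=
  ∃ W : List ((Fin I.dim → ℝ) × ℝ),
    IsCircuitWalk (I.A.map fun q => (q : ℝ)) (fun i => (I.b i : ℝ))
      (I.B.map fun q => (q : ℝ)) (fun i => (I.d i : ℝ))
      (fun i => (I.x i : ℝ)) (fun i => (I.y i : ℝ)) W ∧
    W.length ≤ I.k ∧
    IsSignCompatibleDecomposition (I.A.map fun q => (q : ℝ)) (I.B.map fun q => (q : ℝ))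
      ((fun i => (I.y i : ℝ)) - fun i => (I.x i : ℝ)) W

/-- The alphabet in which instances of SCM-Circ-Dist are written. -/
inductive SCMSymbol where
  | bit (v : Bool)
  | minus
  | slash
  | comma
  | semicolon
  | hash
  deriving DecidableEq, Fintype

namespace SCMSymbol

/-- A natural number in binary. -/
def encodeNat (a : ℕ) : List SCMSymbol :=
  (Computability.encodeNat a).map bit

/-- A rational number in lowest terms, numerator and denominator in binary. -/
def encodeRat (q : ℚ) : List SCMSymbol :=
  (if q.num < 0 then [minus] else []) ++ encodeNat q.num.natAbs ++ [slash] ++ encodeNat q.den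

/-- A rational vector, entry by entry. -/
def encodeVec {a : ℕ} (v : Fin a → ℚ) : List SCMSymbol :=
  (List.ofFn v).flatMap fun q => encodeRat q ++ [comma]

/-- A rational matrix, row by row. -/
def encodeMat {a c : ℕ} (M : Matrix (Fin a) (Fin c) ℚ) : List SCMSymbol :=
  (List.ofFn fun i => encodeVec (M i)).flatMap fun row => row ++ [semicolon]

end SCMSymbol

open SCMSymbol in
/-- The string that describes an instance of SCM-Circ-Dist. -/
def SCMCircDistInstance.encode (I : SCMCircDistInstance) : List SCMSymbol :=
  encodeMat I.A ++ [hash] ++ encodeVec I.b ++ [hash] ++ encodeMat I.B ++ [hash] ++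
    encodeVec I.d ++ [hash] ++ encodeVec I.x ++ [hash] ++ encodeVec I.y ++ [hash] ++
    SCMSymbol.encodeNat I.k

/-! ### Decomposing Eulerian digraphs into two Hamiltonian dicycles -/

/-- A finite digraph, given by the list of its arcs (loops and parallel arcs are allowed). -/
structure ArcDigraph where
  /-- the number of nodes -/
  numNodes : ℕ
  /-- the number of arcs -/
  numArcs : ℕ
  tail : Fin numArcs → Fin numNodes
  head : Fin numArcs → Fin numNodes

namespace ArcDigraph

variable (G : ArcDigraph)

/-- The cyclic sequence of arcs `c` is a closed directed walk. -/
def IsClosedWalk (c : List (Fin G.numArcs)) : Prop :=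
  Cycle.Chain (fun e f => G.head e = G.tail f) (c : Cycle (Fin G.numArcs))

/-- `G` has a closed directed walk that uses each arc exactly once. -/
def IsEulerian : Prop :=
  ∃ c : List (Fin G.numArcs), G.IsClosedWalk c ∧ c.Nodup ∧ ∀ e, e ∈ c

/-- A closed directed walk that visits each node exactly once. -/
def IsHamiltonianDicycle (c : List (Fin G.numArcs)) : Prop :=
  G.IsClosedWalk c ∧ (c.map G.tail).Nodup ∧ ∀ v, v ∈ c.map G.tail

/-- The arcs of `G` can be partitioned into two Hamiltonian dicycles. -/
def HasTwoHamiltonianDicycleDecomposition : Prop :=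
  ∃ c₁ c₂ : List (Fin G.numArcs), G.IsHamiltonianDicycle c₁ ∧ G.IsHamiltonianDicycle c₂ ∧
    c₁.Disjoint c₂ ∧ ∀ e, e ∈ c₁ ∨ e ∈ c₂

end ArcDigraph

/-- A nonempty Eulerian digraph in which every node has in-degree and out-degree `2`. -/
structure TwoRegularEulerianDigraph extends ArcDigraph where
  numNodes_pos : 0 < numNodes
  eulerian : toArcDigraph.IsEulerian
  inDegree : ∀ v, (Finset.univ.filter fun e => head e = v).card = 2
  outDegree : ∀ v, (Finset.univ.filter fun e => tail e = v).card = 2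

/-- The alphabet in which digraphs are written. -/
inductive DigraphSymbol where
  | one
  | comma
  | semicolon
  deriving DecidableEq

instance : Fintype DigraphSymbol :=
  ⟨{.one, .comma, .semicolon}, fun s => by cases s <;> simp⟩

/-- The string that describes a digraph: the number of nodes, and then the tail and the head of
each arc. The nodes are `0, …, numNodes - 1`. Numbers are written in unary; as there are at
least as many arcs as nodes in the digraphs that we consider, the length of the string is
polynomial in the length with binary numbers. -/
def ArcDigraph.encode (G : ArcDigraph) : List DigraphSymbol :=
  List.replicate G.numNodes .one ++ [.semicolon] ++
    (List.finRange G.numArcs).flatMap fun e =>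
      List.replicate (G.tail e : ℕ) .one ++ [.comma] ++
        List.replicate (G.head e : ℕ) .one ++ [.semicolon]

/-! ### Polynomial-time reductions -/

/-- The decision problem `p`, with inputs written by `ea`, has a polynomial-time many-one
reduction to the decision problem `q`, with inputs written by `eb`; that is, `q` is at least as
hard as `p`. -/
def PolyTimeReducible {α β Γ Δ : Type} [Fintype Γ] [Fintype Δ]
    (ea : α → List Γ) (p : α → Prop) (eb : β → List Δ) (q : β → Prop) : Prop :=
  ∃ f : α → β, Nonempty (Turing.TM2ComputableInPolyTime ea eb f) ∧ ∀ a, p a ↔ q (f a)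

/-! The digraph `G` with `m` arcs is sent to the polyhedron of its circulations `z ∈ ℝᵐ` with
`0 ≤ z ≤ 1`, its vertices `0` and `1`, and the step bound `2`.

The inequalities are those of a box, so circuits are the integrally normalized circulations of
minimal support. The indicator vector of a dicycle is a circuit (`indicator_mem_circuits`), because
a circulation supported on a dicycle is constant along it; and a nonnegative circuit has a dicycle
as its support (`exists_dicycle_of_mem_circuits`), because one can follow positive arcs until a node
repeats. In a sign-compatible decomposition of `1 - 0` all steps are nonnegative, so it covers the
arcs of `G` by dicycles, one for each step. A dicycle has at most as many arcs as there are
nodes, and `G` has twice as many arcs as nodes; hence two steps suffice exactly when the arcs split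
into two Hamiltonian dicycles. Conversely, the two indicator vectors form a walk whose steps of
length `1` are maximal, because each of them raises some coordinate to its upper bound.

Conservation of flow is written with a cumulative version of the incidence matrix (`cutMatrix`):
its rows ask for zero net inflow into the sets of nodes above a threshold. This has the same kernel
(`cutMatrix_mulVec_eq_zero`), and a machine that reads node numbers in unary obtains one row after
the other by testing all numbers for being positive and lowering them by one. Taking `m` thresholds
in place of one for each node only adds zero rows, and lets a single counter of length `m` drive all
loops.

The Turing machine is described as a table that pops one symbol per step (`prog`), and
compiled to Mathlib's multi-stack machines. As the output is a stack, the machine writes the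
encoding from its end to its beginning. Each loop has a lemma `runs_…` that gives its effect and a
bound for its number of steps; they add up to the quadratic bound of `runs_machine`. The lemma
`encode_instanceOf` identifies the word that is written with the encoding of the instance. -/

namespace HamiltonReduction

open DigraphSymbol SCMSymbol Turing

/-! ### Machines that pop one symbol per step -/

/-- The work stacks of the machine; `inp` holds the input at the start. -/
inductive Stack where
  | inp
  | store
  | left
  | right
  deriving DecidableEq

instance : Fintype Stack :=
  ⟨{.inp, .store, .left, .right}, fun k => by cases k <;> simp⟩

/-- The labels of the program. After the input has been moved to `store` (`header`, `load`), they
write, in this order, the vectors `y`, `x` and `d`, the rows of the box matrix (`diag…`), the vector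
`b`, and the rows of the cumulative incidence matrix (`inc…`). -/
inductive Label where
  | header
  | load
  | vecY
  | vecX
  | vecDLower
  | vecDUpper
  | diagRow (neg : Bool)
  | diagAfter (neg : Bool)
  | diagAfterBack (neg : Bool)
  | diagBefore (neg : Bool)
  | diagBeforeBack (neg : Bool)
  | vecB
  | incRow
  | incStart
  | incHead
  | incHeadPos
  | incTail (h : Bool)
  | incTailPos (h : Bool)
  | incReturn
  | clear
  deriving DecidableEq, Fintype

/-- What the machine does after it has popped a symbol: it pushes symbols on work stacks, puts the
word `emit` in front of the output, and goes on at `next` (`none` means that it halts). -/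
structure Action where
  push : List (Stack × DigraphSymbol)
  emit : List SCMSymbol
  next : Option Label

/-- The entry `0` of a vector. -/
def zeroEntry : List SCMSymbol := [.slash, .bit true, .comma]

/-- The entry `1` of a vector. -/
def oneEntry : List SCMSymbol := .bit true :: zeroEntry

/-- The entry `-1` of a vector. -/
def negEntry : List SCMSymbol := .minus :: oneEntry

/-- The entry `[h] - [t]` of a vector. -/
def diffEntry : Bool → Bool → List SCMSymbol
  | true, false => oneEntry
  | false, true => negEntry
  | _, _ => zeroEntry

/-- The nonzero entry of the matrix `-I` or `I`. -/
def diagEntry : Bool → List SCMSymbol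
  | true => negEntry
  | false => oneEntry

/-- While a row of `-I` or `I` is written, this stack counts the columns before the diagonal. -/
def before : Bool → Stack
  | true => .left
  | false => .right

/-- While a row of `-I` or `I` is written, this stack counts the columns after the diagonal. -/
def after : Bool → Stack
  | true => .right
  | false => .left

/-- The program: each label names the stack from which it pops, and the action for each result.

* `load` counts the arcs on `left`.
* A row of `-I` or `I` is written from its last entry to its first, with `inp` as scratch stack; the
  diagonal symbol is taken from `before neg` and ends on `after neg`, so that the next round
  writes the previous row. When the rows of `-I` are complete, the counters have changed sides.
* A row of the cumulative incidence matrix is written while the arcs are moved from `store` to `inp`;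
  each node number that is positive loses one symbol on the way. -/
def prog : Label → Stack × (Option DigraphSymbol → Action)
  | .header => (.inp, fun
    | some .one => ⟨[], [], some .header⟩
    | _ => ⟨[(.store, .semicolon)], [], some .load⟩)
  | .load => (.inp, fun
    | some .semicolon => ⟨[(.store, .semicolon), (.left, .one)], [], some .load⟩
    | some s => ⟨[(.store, s)], [], some .load⟩
    | none => ⟨[], [.hash, .bit false, .bit true], some .vecY⟩)
  | .vecY => (.left, fun
    | some s => ⟨[(.right, s)], oneEntry, some .vecY⟩
    | none => ⟨[], [.hash], some .vecX⟩)
  | .vecX => (.right, fun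
    | some s => ⟨[(.left, s)], zeroEntry, some .vecX⟩
    | none => ⟨[], [.hash], some .vecDLower⟩)
  | .vecDLower => (.left, fun
    | some s => ⟨[(.right, s)], zeroEntry, some .vecDLower⟩
    | none => ⟨[], [], some .vecDUpper⟩)
  | .vecDUpper => (.right, fun
    | some s => ⟨[(.left, s)], oneEntry, some .vecDUpper⟩
    | none => ⟨[], [.hash], some (.diagRow true)⟩)
  | .diagRow neg => (before neg, fun
    | some _ => ⟨[], [.semicolon], some (.diagAfter neg)⟩
    | none => if neg then ⟨[], [], some (.diagRow false)⟩ else ⟨[], [.hash], some .vecB⟩)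
  | .diagAfter neg => (after neg, fun
    | some s => ⟨[(.inp, s)], zeroEntry, some (.diagAfter neg)⟩
    | none => ⟨[], diagEntry neg, some (.diagAfterBack neg)⟩)
  | .diagAfterBack neg => (.inp, fun
    | some s => ⟨[(after neg, s)], [], some (.diagAfterBack neg)⟩
    | none => ⟨[(after neg, .one)], [], some (.diagBefore neg)⟩)
  | .diagBefore neg => (before neg, fun
    | some s => ⟨[(.inp, s)], zeroEntry, some (.diagBefore neg)⟩
    | none => ⟨[], [], some (.diagBeforeBack neg)⟩)
  | .diagBeforeBack neg => (.inp, fun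
    | some s => ⟨[(before neg, s)], [], some (.diagBeforeBack neg)⟩
    | none => ⟨[], [], some (.diagRow neg)⟩)
  | .vecB => (.left, fun
    | some s => ⟨[(.right, s)], zeroEntry, some .vecB⟩
    | none => ⟨[], [.hash], some .incRow⟩)
  | .incRow => (.right, fun
    | some _ => ⟨[], [.semicolon], some .incStart⟩
    | none => ⟨[], [], some .clear⟩)
  | .incStart => (.store, fun _ => ⟨[(.inp, .semicolon)], [], some .incHead⟩)
  | .incHead => (.store, fun
    | some .one => ⟨[], [], some .incHeadPos⟩
    | some _ => ⟨[(.inp, .comma)], [], some (.incTail false)⟩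
    | none => ⟨[], [], some .incReturn⟩)
  | .incHeadPos => (.store, fun
    | some .one => ⟨[(.inp, .one)], [], some .incHeadPos⟩
    | _ => ⟨[(.inp, .comma)], [], some (.incTail true)⟩)
  | .incTail h => (.store, fun
    | some .one => ⟨[], [], some (.incTailPos h)⟩
    | _ => ⟨[(.inp, .semicolon)], diffEntry h false, some .incHead⟩)
  | .incTailPos h => (.store, fun
    | some .one => ⟨[(.inp, .one)], [], some (.incTailPos h)⟩
    | _ => ⟨[(.inp, .semicolon)], diffEntry h true, some .incHead⟩)
  | .incReturn => (.inp, fun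
    | some s => ⟨[(.store, s)], [], some .incReturn⟩
    | none => ⟨[], [], some .incRow⟩)
  | .clear => (.store, fun
    | some _ => ⟨[], [], some .clear⟩
    | none => ⟨[], [], none⟩)

/-- A configuration: the current label, the work stacks, and the output written so far. -/
structure Config where
  label : Option Label
  stk : Stack → List DigraphSymbol
  out : List SCMSymbol

/-- Push symbols on the work stacks, one after the other. -/
def pushAll (ps : List (Stack × DigraphSymbol)) (S : Stack → List DigraphSymbol) :
    Stack → List DigraphSymbol :=
  ps.foldl (fun S p => Function.update S p.1 (p.2 :: S p.1)) S

/-- The configuration after `l` is executed. -/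
def execute (l : Label) (S : Stack → List DigraphSymbol) (o : List SCMSymbol) : Config :=
  let a := (prog l).2 (S (prog l).1).head?
  ⟨a.next, pushAll a.push (Function.update S (prog l).1 (S (prog l).1).tail), a.emit ++ o⟩

/-- One step of the machine. -/
def Config.step : Config → Option Config
  | ⟨none, _, _⟩ => none
  | ⟨some l, S, o⟩ => some (execute l S o)

/-- The machine gets from the first configuration to the second in at most the given number of
steps. -/
inductive Runs : Config → Config → ℕ → Prop
  | refl (c : Config) (n : ℕ) : Runs c c n
  | head {c c₁ c₂ : Config} {n : ℕ} : c.step = some c₁ → Runs c₁ c₂ n → Runs c c₂ (n + 1)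

theorem Runs.mono {c c' : Config} {n k : ℕ} (h : Runs c c' n) (hk : n ≤ k) : Runs c c' k := by
  induction h generalizing k with
  | refl c n => exact .refl c k
  | head hs _ ih =>
    obtain ⟨k, rfl⟩ : ∃ j, k = j + 1 := ⟨k - 1, by omega⟩
    exact .head hs (ih (by omega))

theorem Runs.trans {c c₁ c₂ : Config} {n k : ℕ} (h : Runs c c₁ n) (h' : Runs c₁ c₂ k) :
    Runs c c₂ (n + k) := by
  induction h with
  | refl c n => exact h'.mono (by omega)
  | head hs _ ih => exact (Runs.head hs (ih h')).mono (by omega)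

theorem Runs.step {l : Label} {S : Stack → List DigraphSymbol} {o : List SCMSymbol} {c : Config}
    {n : ℕ} (h : Runs (execute l S o) c n) : Runs ⟨some l, S, o⟩ c (n + 1) :=
  .head rfl h

/-! ### Compilation to a multi-stack Turing machine -/

/-- The alphabets of the stacks; `none` is the output stack. -/
abbrev Alphabet : Option Stack → Type
  | none => SCMSymbol
  | some _ => DigraphSymbol

/-- Statements of the compiled machine. Its internal state is the symbol popped last. -/
abbrev Code : Type := TM2.Stmt Alphabet Label (Option DigraphSymbol)

/-- Push the symbols `ps` on work stacks. -/
def pushCode (ps : List (Stack × DigraphSymbol)) (q : Code) : Code :=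
  ps.foldr (fun p q => .push (some p.1) (fun _ => p.2) q) q

/-- Push a word on the output stack, last symbol first. -/
def emitCode : List SCMSymbol → Code → Code
  | [], q => q
  | a :: os, q => emitCode os (.push none (fun _ => a) q)

/-- Reset the internal state and jump. -/
def jumpCode : Option Label → Code
  | none => .load (fun _ => none) .halt
  | some l => .load (fun _ => none) (.goto fun _ => l)

/-- The statement that performs an action. -/
def actionCode (a : Action) : Code := pushCode a.push (emitCode a.emit (jumpCode a.next))

/-- The statement of a label. -/
def labelCode (l : Label) : Code :=
  .pop (some (prog l).1) (fun _ s => s) <|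
    .branch (fun v => decide (v = none)) (actionCode ((prog l).2 none)) <|
    .branch (fun v => decide (v = some .one)) (actionCode ((prog l).2 (some .one))) <|
    .branch (fun v => decide (v = some .comma)) (actionCode ((prog l).2 (some .comma))) <|
    actionCode ((prog l).2 (some .semicolon))

/-- The machine of the reduction. -/
def machine : FinTM2 where
  K := Option Stack
  k₀ := some .inp
  k₁ := none
  Γ := Alphabet
  Λ := Label
  main := .header
  σ := Option DigraphSymbol
  initialState := none
  Γk₀Fin := inferInstanceAs (Fintype DigraphSymbol)
  m := labelCode

/-- The stacks of the compiled machine. -/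
def allStacks (S : Stack → List DigraphSymbol) (o : List SCMSymbol) :
    ∀ k : Option Stack, List (Alphabet k)
  | none => o
  | some k => S k

/-- A configuration as a configuration of the compiled machine. -/
def Config.toCfg (c : Config) : TM2.Cfg Alphabet Label (Option DigraphSymbol) :=
  ⟨c.label, none, allStacks c.stk c.out⟩

theorem update_allStacks_none (S : Stack → List DigraphSymbol) (o o' : List SCMSymbol) :
    Function.update (allStacks S o) none o' = allStacks S o' := by
  funext k; cases k <;> simp [allStacks]

theorem update_allStacks_some (S : Stack → List DigraphSymbol) (o : List SCMSymbol) (k : Stack)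
    (s : List DigraphSymbol) :
    Function.update (allStacks S o) (some k) s = allStacks (Function.update S k s) o := by
  funext k'
  cases k' with
  | none => simp [allStacks]
  | some k' => by_cases h : k' = k <;> [subst h; skip] <;> simp [allStacks, Function.update, *]

theorem stepAux_emitCode (os : List SCMSymbol) (q : Code) (v : Option DigraphSymbol)
    (S : Stack → List DigraphSymbol) (o : List SCMSymbol) :
    TM2.stepAux (emitCode os q) v (allStacks S o) = TM2.stepAux q v (allStacks S (os ++ o)) := by
  induction os generalizing q with
  | nil => rfl
  | cons a os ih => rw [emitCode, ih, TM2.stepAux, update_allStacks_none]; rfl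

theorem stepAux_pushCode (ps : List (Stack × DigraphSymbol)) (q : Code)
    (v : Option DigraphSymbol) (S : Stack → List DigraphSymbol) (o : List SCMSymbol) :
    TM2.stepAux (pushCode ps q) v (allStacks S o) =
      TM2.stepAux q v (allStacks (pushAll ps S) o) := by
  induction ps generalizing S with
  | nil => rfl
  | cons p ps ih =>
    change TM2.stepAux (pushCode ps q) v _ = _
    rw [update_allStacks_some, ih]; rfl

theorem stepAux_actionCode (a : Action) (v : Option DigraphSymbol)
    (S : Stack → List DigraphSymbol) (o : List SCMSymbol) :
    TM2.stepAux (actionCode a) v (allStacks S o) =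
      Config.toCfg ⟨a.next, pushAll a.push S, a.emit ++ o⟩ := by
  rw [actionCode, stepAux_pushCode, stepAux_emitCode]
  cases a.next <;> rfl

/-- The compiled machine simulates the table step by step. -/
theorem step_toCfg (c : Config) :
    TM2.step labelCode c.toCfg = c.step.map Config.toCfg := by
  obtain ⟨_ | l, S, o⟩ := c
  · rfl
  · simp only [Config.toCfg, TM2.step, Config.step, Option.map_some, Option.some.injEq]
    rw [labelCode, TM2.stepAux, update_allStacks_some, execute]
    have h : allStacks S o (some (prog l).1) = S (prog l).1 := rfl
    rw [h]
    generalize (S (prog l).1).head? = s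
    generalize Function.update S _ _ = S'
    rcases s with _ | _ | _ | _ <;> simp [stepAux_actionCode, Config.toCfg]

theorem Runs.exists_iterate {c c' : Config} {n : ℕ} (h : Runs c c' n) :
    ∃ j ≤ n, (flip bind machine.step)^[j] (some c.toCfg) = some c'.toCfg := by
  induction h with
  | refl c n => exact ⟨0, by omega, rfl⟩
  | @head c c₁ c₂ n hs _ ih =>
    obtain ⟨j, hj, e⟩ := ih
    refine ⟨j + 1, by omega, ?_⟩
    have h : flip bind machine.step (some c.toCfg) = some c₁.toCfg := by
      have := step_toCfg c
      rw [hs] at this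
      exact this
    refine Eq.trans ?_ e
    exact congrArg (flip bind machine.step)^[j] h

/-! ### Loops that move a stack -/

/-- The work stacks `inp`, `store`, `left` and `right` with the given contents. -/
def contents (i s l r : List DigraphSymbol) : Stack → List DigraphSymbol
  | .inp => i
  | .store => s
  | .left => l
  | .right => r

section
variable (i s l r z : List DigraphSymbol)

@[simp] theorem update_inp :
    Function.update (contents i s l r) .inp z = contents z s l r := by
  funext k; cases k <;> rfl

@[simp] theorem update_store :
    Function.update (contents i s l r) .store z = contents i z l r := by
  funext k; cases k <;> rfl

@[simp] theorem update_left :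
    Function.update (contents i s l r) .left z = contents i s z r := by
  funext k; cases k <;> rfl

@[simp] theorem update_right :
    Function.update (contents i s l r) .right z = contents i s l z := by
  funext k; cases k <;> rfl

@[simp] theorem contents_inp : contents i s l r .inp = i := rfl
@[simp] theorem contents_store : contents i s l r .store = s := rfl
@[simp] theorem contents_left : contents i s l r .left = l := rfl
@[simp] theorem contents_right : contents i s l r .right = r := rfl

end

/-- `n` copies of the symbol `one`. -/
abbrev ones (n : ℕ) : List DigraphSymbol := List.replicate n .one

/-- A word, written `n` times. -/
def copies (n : ℕ) (w : List SCMSymbol) : List SCMSymbol := (List.replicate n w).flatten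

theorem copies_succ' (n : ℕ) (w o : List SCMSymbol) :
    copies n w ++ (w ++ o) = copies (n + 1) w ++ o := by
  simp [copies, List.replicate_succ']

/-- A loop that moves the stack `a` to the stack `b` and writes `w` for each symbol. -/
theorem runs_move {l : Label} {a b : Stack} {w : List SCMSymbol} (hab : a ≠ b)
    (hl : (prog l).1 = a) (h : ∀ s, (prog l).2 (some s) = ⟨[(b, s)], w, some l⟩)
    (S : Stack → List DigraphSymbol) (o : List SCMSymbol) :
    Runs ⟨some l, S, o⟩
      ⟨some l, Function.update (Function.update S a []) b ((S a).reverse ++ S b),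
        copies (S a).length w ++ o⟩ (S a).length := by
  generalize hL : S a = L
  induction L generalizing S o with
  | nil =>
    have h₁ : Function.update (Function.update S a []) b (([] : List _).reverse ++ S b) = S := by
      rw [List.reverse_nil, List.nil_append, ← hL, Function.update_eq_self]
      exact Function.update_eq_self _ _
    rw [h₁]
    exact .refl _ _
  | cons s L ih =>
    refine Runs.step ?_
    have he : execute l S o =
        ⟨some l, Function.update (Function.update S a L) b (s :: S b), w ++ o⟩ := by
      simp [execute, hl, hL, h, pushAll, hab.symm]
    have := ih (Function.update (Function.update S a L) b (s :: S b)) (w ++ o) (by simp [hab])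
    rw [copies_succ'] at this
    rw [he, List.length_cons]
    convert this using 2
    funext k
    by_cases hk : k = b
    · subst hk; simp
    · by_cases hk' : k = a
      · subst hk'; simp [hk]
      · simp [hk, hk']

/-! ### Runs of the program -/

/-- The string of an arc, given by the numbers of its tail and its head. -/
def arcWord (a : ℕ × ℕ) : List DigraphSymbol :=
  ones a.1 ++ [.comma] ++ ones a.2 ++ [.semicolon]

/-- A list of arcs, read from a stack on which the strings of the arcs in the opposite order have
been pushed; the semicolon on top of that stack is left out. -/
def revWord (l : List (ℕ × ℕ)) : List DigraphSymbol :=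
  l.flatMap fun a => ones a.2 ++ [.comma] ++ ones a.1 ++ [.semicolon]

/-- Lower the numbers of all tails and heads by one, where they are positive. -/
def lower (l : List (ℕ × ℕ)) : List (ℕ × ℕ) := l.map fun a => (a.1 - 1, a.2 - 1)

/-- The row of the cumulative incidence matrix that belongs to the threshold `v`. -/
def incEntries (v : ℕ) (l : List (ℕ × ℕ)) : List SCMSymbol :=
  l.flatMap fun a => diffEntry (decide (v < a.2)) (decide (v < a.1))

/-- The rows of the cumulative incidence matrix for the thresholds `p - 1, …, 0`. -/
def incRows (p : ℕ) (l : List (ℕ × ℕ)) : List SCMSymbol :=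
  (List.range p).flatMap fun i => incEntries (p - 1 - i) l ++ [.semicolon]

/-- The row of `-I` or `I` whose nonzero entry has `i` entries on its left and `j` entries on its
right. -/
def diagEntries (neg : Bool) (i j : ℕ) : List SCMSymbol :=
  copies i zeroEntry ++ diagEntry neg ++ copies j zeroEntry ++ [.semicolon]

/-- The first `p` rows of the matrix `-I` or `I` with `m` columns. -/
def diagRows (neg : Bool) (m p : ℕ) : List SCMSymbol :=
  (List.range p).flatMap fun i => diagEntries neg i (m - 1 - i)

theorem incEntries_lower (v : ℕ) (l : List (ℕ × ℕ)) :
    incEntries v (lower l) = incEntries (v + 1) l := by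
  simp [incEntries, lower, List.flatMap_map, Nat.lt_sub_iff_add_lt]

theorem lower_reverse (l : List (ℕ × ℕ)) : (lower l).reverse = lower l.reverse := by
  simp [lower]

theorem incRows_succ (p : ℕ) (l : List (ℕ × ℕ)) :
    incRows (p + 1) l = incRows p (lower l) ++ (incEntries 0 l ++ [.semicolon]) := by
  rw [incRows, List.range_succ, List.flatMap_append, incRows]
  congr 1
  · refine List.flatMap_congr fun i hi => ?_
    rw [incEntries_lower]
    have : i < p := List.mem_range.1 hi
    congr 2
    omega
  · simp

theorem reverse_flatMap_arcWord (l : List (ℕ × ℕ)) :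
    (l.flatMap arcWord).reverse ++ [.semicolon] = .semicolon :: revWord l.reverse := by
  induction l with
  | nil => rfl
  | cons a l ih =>
    rw [List.flatMap_cons, List.reverse_append, List.reverse_cons, revWord, List.flatMap_append,
      ← revWord, ← List.cons_append, ← ih]
    simp [arcWord]

theorem count_flatMap_arcWord (l : List (ℕ × ℕ)) :
    (l.flatMap arcWord).count .semicolon = l.length := by
  induction l with
  | nil => rfl
  | cons a l ih =>
    rw [List.flatMap_cons, List.count_append, ih]
    simp [arcWord, List.count_replicate]
    omega

theorem length_revWord_lower_le (l : List (ℕ × ℕ)) :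
    (revWord (lower l)).length ≤ (revWord l).length := by
  induction l with
  | nil => rfl
  | cons a l ih =>
    simp only [revWord, lower, List.map_cons, List.flatMap_cons, List.length_append,
      List.length_replicate] at ih ⊢
    omega

theorem runs_header (n : ℕ) (i : List DigraphSymbol) :
    Runs ⟨some .header, contents (ones n ++ .semicolon :: i) [] [] [], []⟩
      ⟨some .load, contents i [.semicolon] [] [], []⟩ (n + 1) := by
  induction n with
  | zero =>
    refine .step ?_
    simpa [execute, prog, pushAll] using Runs.refl _ _
  | succ n ih =>
    refine .step ?_
    simpa [execute, prog, pushAll, List.replicate_succ] using ih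

theorem runs_load (i s : List DigraphSymbol) (p : ℕ) :
    Runs ⟨some .load, contents i s (ones p) [], []⟩
      ⟨some .load, contents [] (i.reverse ++ s) (ones (i.count .semicolon + p)) [], []⟩
      i.length := by
  induction i generalizing s p with
  | nil => simpa using Runs.refl _ _
  | cons a i ih =>
    refine .step ?_
    cases a with
    | semicolon =>
      have := ih (.semicolon :: s) (p + 1)
      simpa [execute, prog, pushAll, ← List.replicate_succ, Nat.add_right_comm, ← Nat.add_assoc]
        using this
    | _ => simpa [execute, prog, pushAll] using ih (_ :: s) p

theorem runs_load_end (s : List DigraphSymbol) (m : ℕ) :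
    Runs ⟨some .load, contents [] s (ones m) [], []⟩
      ⟨some .vecY, contents [] s (ones m) [], [.hash, .bit false, .bit true]⟩ 1 := by
  refine .step ?_
  simpa [execute, prog, pushAll] using Runs.refl _ _

/-- A loop that moves the left counter to the right one and writes `w` for each symbol. -/
theorem runs_left_right {l l' : Label} {w e : List SCMSymbol} (hl : (prog l).1 = .left)
    (h : ∀ s, (prog l).2 (some s) = ⟨[(.right, s)], w, some l⟩)
    (h' : (prog l).2 none = ⟨[], e, some l'⟩) (s : List DigraphSymbol) (m : ℕ)
    (o : List SCMSymbol) :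
    Runs ⟨some l, contents [] s (ones m) [], o⟩
      ⟨some l', contents [] s [] (ones m), e ++ (copies m w ++ o)⟩ (m + 1) := by
  have := runs_move (by decide) hl h (contents [] s (ones m) []) o
  simp only [contents_left, contents_right, update_left, update_right, List.length_replicate,
    List.reverse_replicate, List.append_nil] at this
  refine this.trans (.step (n := 0) ?_)
  simpa [execute, hl, h', pushAll] using Runs.refl _ _

/-- A loop that moves the right counter to the left one and writes `w` for each symbol. -/
theorem runs_right_left {l l' : Label} {w e : List SCMSymbol} (hl : (prog l).1 = .right)
    (h : ∀ s, (prog l).2 (some s) = ⟨[(.left, s)], w, some l⟩)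
    (h' : (prog l).2 none = ⟨[], e, some l'⟩) (s : List DigraphSymbol) (m : ℕ)
    (o : List SCMSymbol) :
    Runs ⟨some l, contents [] s [] (ones m), o⟩
      ⟨some l', contents [] s (ones m) [], e ++ (copies m w ++ o)⟩ (m + 1) := by
  have := runs_move (by decide) hl h (contents [] s [] (ones m)) o
  simp only [contents_left, contents_right, update_left, update_right, List.length_replicate,
    List.reverse_replicate, List.append_nil] at this
  refine this.trans (.step (n := 0) ?_)
  simpa [execute, hl, h', pushAll] using Runs.refl _ _

/-- The work stacks between two rows of `-I` or `I`: `p` symbols on `before neg`, that is, `p` rows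
still to be written, and `r` symbols on `after neg`. -/
def diagContents (neg : Bool) (s : List DigraphSymbol) (p r : ℕ) :
    Stack → List DigraphSymbol :=
  if neg then contents [] s (ones p) (ones r) else contents [] s (ones r) (ones p)

theorem runs_diagRow_step (neg : Bool) (s : List DigraphSymbol) (p r : ℕ) (o : List SCMSymbol) :
    Runs ⟨some (.diagRow neg), diagContents neg s (p + 1) r, o⟩
      ⟨some (.diagRow neg), diagContents neg s p (r + 1), diagEntries neg p r ++ o⟩
      (2 * (p + r) + 6) := by
  have h₁ := runs_move (l := .diagAfter neg) (a := after neg) (b := .inp) (by cases neg <;> decide)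
    rfl (fun _ => rfl) (diagContents neg s p r) (.semicolon :: o)
  have h₂ := runs_move (l := .diagAfterBack neg) (a := .inp) (b := after neg)
    (by cases neg <;> decide) rfl (fun _ => rfl)
    (Function.update (diagContents neg s p 0) .inp (ones r))
    (diagEntry neg ++ (copies r zeroEntry ++ .semicolon :: o))
  have h₃ := runs_move (l := .diagBefore neg) (a := before neg) (b := .inp)
    (by cases neg <;> decide) rfl (fun _ => rfl) (diagContents neg s p (r + 1))
    (diagEntry neg ++ (copies r zeroEntry ++ .semicolon :: o))
  have h₄ := runs_move (l := .diagBeforeBack neg) (a := .inp) (b := before neg)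
    (by cases neg <;> decide) rfl (fun _ => rfl)
    (Function.update (diagContents neg s 0 (r + 1)) .inp (ones p))
    (copies p zeroEntry ++ (diagEntry neg ++ (copies r zeroEntry ++ .semicolon :: o)))
  have hc : ∀ n o, copies n [] ++ o = o := by simp [copies]
  rw [hc] at h₂ h₄
  have k₁ := h₁.trans (Runs.step (Runs.refl _ 0))
  have k₂ := h₂.trans (Runs.step (Runs.refl _ 0))
  have k₃ := h₃.trans (Runs.step (Runs.refl _ 0))
  have k₄ := h₄.trans (Runs.step (Runs.refl _ 0))
  refine Runs.step (Runs.mono (n := (r + 1) + ((r + 1) + ((p + 1) + (p + 1)))) ?_ (by omega))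
  cases neg <;>
  · simp only [diagContents, before, after, if_true, if_false, Bool.false_eq_true, contents_left,
      contents_right, contents_inp, update_left, update_right, update_inp, List.reverse_replicate,
      List.length_replicate, List.append_nil, List.replicate_zero, execute, prog, pushAll,
      List.head?_nil, List.tail_nil, List.foldl_cons, List.foldl_nil, List.nil_append,
      List.replicate_succ, List.head?_cons, List.tail_cons,
      diagEntries, List.append_assoc, List.cons_append] at k₁ k₂ k₃ k₄ ⊢
    exact k₁.trans (k₂.trans (k₃.trans k₄))

theorem runs_diagRow (neg : Bool) (s : List DigraphSymbol) (m p r : ℕ) (hm : p + r = m)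
    (o : List SCMSymbol) :
    Runs ⟨some (.diagRow neg), diagContents neg s p r, o⟩
      ⟨some (.diagRow neg), diagContents neg s 0 m, diagRows neg m p ++ o⟩ (p * (2 * m + 6)) := by
  induction p generalizing r o with
  | zero =>
    obtain rfl : r = m := by omega
    simpa [diagRows] using Runs.refl _ _
  | succ p ih =>
    have h := (runs_diagRow_step neg s p r o).trans (ih (r + 1) (by omega) _)
    obtain rfl : r = m - 1 - p := by omega
    rw [diagRows, List.range_succ, List.flatMap_append, ← diagRows, List.flatMap_singleton,
      List.append_assoc]
    refine h.mono ?_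
    have : 2 * (p + (m - 1 - p)) ≤ 2 * m := by omega
    nlinarith

theorem ones_append_cons (n : ℕ) (x : List DigraphSymbol) :
    ones n ++ .one :: x = .one :: (ones n ++ x) := by
  rw [List.append_cons, ← List.replicate_succ', List.replicate_succ, List.cons_append]

theorem runs_diagRow_true_end (s : List DigraphSymbol) (m : ℕ) (o : List SCMSymbol) :
    Runs ⟨some (.diagRow true), diagContents true s 0 m, o⟩
      ⟨some (.diagRow false), diagContents false s m 0, o⟩ 1 := by
  refine .step ?_
  simpa [execute, prog, pushAll, diagContents, before] using Runs.refl _ _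

theorem runs_diagRow_false_end (s : List DigraphSymbol) (m : ℕ) (o : List SCMSymbol) :
    Runs ⟨some (.diagRow false), diagContents false s 0 m, o⟩
      ⟨some .vecB, contents [] s (ones m) [], .hash :: o⟩ 1 := by
  refine .step ?_
  simpa [execute, prog, pushAll, diagContents, before] using Runs.refl _ _

theorem runs_incHeadPos (h : ℕ) (i s l r : List DigraphSymbol) (o : List SCMSymbol) :
    Runs ⟨some .incHeadPos, contents i (ones h ++ .comma :: s) l r, o⟩
      ⟨some (.incTail true), contents (.comma :: (ones h ++ i)) s l r, o⟩ (h + 1) := by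
  induction h generalizing i with
  | zero =>
    refine .step ?_
    simpa [execute, prog, pushAll] using Runs.refl _ _
  | succ h ih =>
    refine .step ?_
    have := ih (.one :: i)
    rw [ones_append_cons] at this
    simpa [execute, prog, pushAll, List.replicate_succ] using this

theorem runs_incHead (h : ℕ) (i s l r : List DigraphSymbol) (o : List SCMSymbol) :
    Runs ⟨some .incHead, contents i (ones h ++ .comma :: s) l r, o⟩
      ⟨some (.incTail (decide (0 < h))), contents (.comma :: (ones (h - 1) ++ i)) s l r, o⟩
      (h + 1) := by
  refine .step ?_
  cases h with
  | zero => simpa [execute, prog, pushAll] using Runs.refl _ _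
  | succ h =>
    simpa [execute, prog, pushAll, List.replicate_succ] using runs_incHeadPos h i s l r o

theorem runs_incTailPos (b : Bool) (t : ℕ) (i s l r : List DigraphSymbol) (o : List SCMSymbol) :
    Runs ⟨some (.incTailPos b), contents i (ones t ++ .semicolon :: s) l r, o⟩
      ⟨some .incHead, contents (.semicolon :: (ones t ++ i)) s l r, diffEntry b true ++ o⟩
      (t + 1) := by
  induction t generalizing i with
  | zero =>
    refine .step ?_
    simpa [execute, prog, pushAll] using Runs.refl _ _
  | succ t ih =>
    refine .step ?_
    have := ih (.one :: i)
    rw [ones_append_cons] at this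
    simpa [execute, prog, pushAll, List.replicate_succ] using this

theorem runs_incTail (b : Bool) (t : ℕ) (i s l r : List DigraphSymbol) (o : List SCMSymbol) :
    Runs ⟨some (.incTail b), contents i (ones t ++ .semicolon :: s) l r, o⟩
      ⟨some .incHead, contents (.semicolon :: (ones (t - 1) ++ i)) s l r,
        diffEntry b (decide (0 < t)) ++ o⟩ (t + 1) := by
  refine .step ?_
  cases t with
  | zero => simpa [execute, prog, pushAll] using Runs.refl _ _
  | succ t =>
    simpa [execute, prog, pushAll, List.replicate_succ] using runs_incTailPos b t i s l r o

/-- One pass over the arcs writes the row for the threshold `0` and lowers all node numbers. -/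
theorem runs_incEntries (q : List (ℕ × ℕ)) (i l r : List DigraphSymbol) (o : List SCMSymbol) :
    Runs ⟨some .incHead, contents i (revWord q) l r, o⟩
      ⟨some .incHead, contents ((revWord (lower q)).reverse ++ i) [] l r,
        incEntries 0 q.reverse ++ o⟩ (revWord q).length := by
  induction q generalizing i o with
  | nil => simpa [revWord, lower, incEntries] using Runs.refl _ _
  | cons a q ih =>
    have h := (runs_incHead a.2 i (ones a.1 ++ .semicolon :: revWord q) l r o).trans
      ((runs_incTail _ a.1 _ (revWord q) l r o).trans (ih _ _))
    convert h using 1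
    · simp [revWord]
    · simp [revWord, lower, incEntries]
    · simp [revWord]; omega

theorem runs_incRow_step (q : List (ℕ × ℕ)) (p : ℕ) (o : List SCMSymbol) :
    Runs ⟨some .incRow, contents [] (.semicolon :: revWord q) [] (ones (p + 1)), o⟩
      ⟨some .incRow, contents [] (.semicolon :: revWord (lower q)) [] (ones p),
        incEntries 0 q.reverse ++ .semicolon :: o⟩ (2 * (revWord q).length + 5) := by
  have h₁ := runs_incEntries q [.semicolon] [] (ones p) (.semicolon :: o)
  have h₂ := runs_move (l := .incReturn) (a := .inp) (b := .store) (by decide) rfl (fun _ => rfl)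
    (contents ((revWord (lower q)).reverse ++ [.semicolon]) [] [] (ones p))
    (incEntries 0 q.reverse ++ .semicolon :: o)
  simp only [contents_inp, contents_store, update_inp, update_store, List.append_nil,
    List.reverse_append, List.reverse_reverse, List.reverse_singleton, List.singleton_append] at h₂
  have hlen : ((revWord (lower q)).reverse ++ [DigraphSymbol.semicolon]).length ≤
      (revWord q).length + 1 := by simpa using length_revWord_lower_le q
  have hc : ∀ n o, copies n [] ++ o = o := by simp [copies]
  rw [hc] at h₂
  have h₁' := h₁.trans (Runs.step (Runs.refl _ 0))
  have h₂' := (h₂.mono hlen).trans (Runs.step (Runs.refl _ 0))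
  simp only [execute, prog, pushAll, contents_inp, contents_store, update_inp, List.head?_nil,
    List.tail_nil, List.foldl_nil, List.nil_append, update_store] at h₁' h₂'
  refine Runs.mono (n := (revWord q).length + (0 + 1) + ((revWord q).length + 1 + (0 + 1)) + 1 + 1)
    (Runs.step (Runs.step ?_)) (by omega)
  simpa [execute, prog, pushAll, List.replicate_succ] using h₁'.trans h₂'

/-- After the rows have been written, lowered copies `q'` of the arcs are left on `store`. -/
theorem runs_incRow (q : List (ℕ × ℕ)) (p N : ℕ) (hN : (revWord q).length ≤ N)
    (o : List SCMSymbol) :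
    ∃ q' : List (ℕ × ℕ), (revWord q').length ≤ N ∧
      Runs ⟨some .incRow, contents [] (.semicolon :: revWord q) [] (ones p), o⟩
        ⟨some .incRow, contents [] (.semicolon :: revWord q') [] [],
          incRows p q.reverse ++ o⟩ (p * (2 * N + 5)) := by
  induction p generalizing q o with
  | zero => exact ⟨q, hN, by simpa [incRows] using Runs.refl _ _⟩
  | succ p ih =>
    obtain ⟨q', hq', h⟩ := ih (lower q) ((length_revWord_lower_le q).trans hN)
      (incEntries 0 q.reverse ++ .semicolon :: o)
    refine ⟨q', hq', ?_⟩
    have h' := (runs_incRow_step q p o).trans h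
    rw [incRows_succ, ← lower_reverse, List.append_assoc, List.append_assoc]
    refine h'.mono ?_
    nlinarith

theorem runs_clear (s : List DigraphSymbol) (o : List SCMSymbol) :
    Runs ⟨some .clear, contents [] s [] [], o⟩ ⟨none, contents [] [] [] [], o⟩
      (s.length + 1) := by
  induction s with
  | nil =>
    refine .step ?_
    simpa [execute, prog, pushAll] using Runs.refl _ _
  | cons a s ih =>
    refine .step ?_
    simpa [execute, prog, pushAll] using ih

/-- The word that the machine writes for a digraph with the given list of arcs. -/
def outputWord (l : List (ℕ × ℕ)) : List SCMSymbol :=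
  incRows l.length l ++ [.hash] ++ copies l.length zeroEntry ++ [.hash] ++
    (diagRows false l.length l.length ++ diagRows true l.length l.length) ++ [.hash] ++
    (copies l.length oneEntry ++ copies l.length zeroEntry) ++ [.hash] ++
    copies l.length zeroEntry ++ [.hash] ++ copies l.length oneEntry ++ [.hash] ++
    [.bit false, .bit true]

/-- The string of a digraph with `n` nodes and the given list of arcs. -/
def inputWord (n : ℕ) (l : List (ℕ × ℕ)) : List DigraphSymbol :=
  ones n ++ .semicolon :: l.flatMap arcWord

/-- The machine writes the output word within quadratic time and leaves its work stacks empty. -/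
theorem runs_machine (n : ℕ) (l : List (ℕ × ℕ)) :
    Runs ⟨some .header, contents (inputWord n l) [] [] [], []⟩
      ⟨none, contents [] [] [] [], outputWord l⟩
      (6 * (inputWord n l).length ^ 2 + 50 * (inputWord n l).length + 50) := by
  set N := (inputWord n l).length with hN
  set m := l.length with hm
  have hlen : N = n + (l.flatMap arcWord).length + 1 := by simp [hN, inputWord]; omega
  have hrev : (revWord l.reverse).length = (l.flatMap arcWord).length := by
    simpa using (congrArg List.length (reverse_flatMap_arcWord l)).symm
  have hmN : m ≤ (l.flatMap arcWord).length := by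
    rw [hm, ← count_flatMap_arcWord]; exact List.count_le_length
  have h₁ := runs_header n (l.flatMap arcWord)
  have h₂ := runs_load (l.flatMap arcWord) [.semicolon] 0
  rw [reverse_flatMap_arcWord, count_flatMap_arcWord, Nat.add_zero, ← hm] at h₂
  set s := DigraphSymbol.semicolon :: revWord l.reverse with hs
  have h₃ := h₂.trans (runs_load_end s m)
  have h₄ := runs_left_right (l := .vecY) rfl (fun _ => rfl) rfl s m [.hash, .bit false, .bit true]
  have h₅ := h₄.trans <| runs_right_left (l := .vecX) rfl (fun _ => rfl) rfl s m _
  have h₆ := h₅.trans <| runs_left_right (l := .vecDLower) rfl (fun _ => rfl) rfl s m _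
  have h₇ := h₆.trans <| runs_right_left (l := .vecDUpper) rfl (fun _ => rfl) rfl s m _
  have h₈ := h₇.trans <| (runs_diagRow true s m m 0 rfl _).trans (runs_diagRow_true_end s m _)
  have h₉ := h₈.trans <| (runs_diagRow false s m m 0 rfl _).trans (runs_diagRow_false_end s m _)
  have h₁₀ := h₉.trans <| runs_left_right (l := .vecB) rfl (fun _ => rfl) rfl s m _
  obtain ⟨q, hq, h₁₁⟩ := runs_incRow l.reverse m _ hrev.le _
  have h₁₂ := h₁₀.trans h₁₁
  have h₁₃ := h₁₂.trans <| Runs.step (n := (revWord q).length + 2) (c := ⟨none, contents [] [] [] [],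
    outputWord l⟩) <| by
      have := runs_clear (.semicolon :: revWord q) (outputWord l)
      simpa [execute, prog, pushAll, outputWord, ← hm] using this
  have h₁₄ := h₁.trans (h₃.trans h₁₃)
  refine h₁₄.mono ?_
  have : m * (2 * m + 6) ≤ N * (2 * N + 6) := Nat.mul_le_mul (by omega) (by omega)
  have : m * (2 * (l.flatMap arcWord).length + 5) ≤ N * (2 * N + 5) :=
    Nat.mul_le_mul (by omega) (by omega)
  nlinarith

/-! ### Circulations and dicycles -/

section Circulations

variable {G : ArcDigraph}

/-- A real function on the arcs for which inflow and outflow agree at every node. -/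
def IsCirculation (G : ArcDigraph) (z : Fin G.numArcs → ℝ) : Prop :=
  ∀ v, ∑ e, (if G.head e = v then z e else 0) = ∑ e, if G.tail e = v then z e else 0

/-- The indicator vector of the arcs of a list. -/
def indicator (c : List (Fin G.numArcs)) : Fin G.numArcs → ℝ := fun e => if e ∈ c then 1 else 0

/-- Along a chain, the heads are the tails shifted by one place. -/
theorem map_eq_of_isChain {α β : Type*} {f g : α → β} {a b : α} {l : List α}
    (h : List.IsChain (fun e e' => f e = g e') (a :: (l ++ [b]))) :
    (a :: l).map f = (l ++ [b]).map g := by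
  induction l generalizing a with
  | nil => simpa using h
  | cons x l ih =>
    rw [List.cons_append, List.isChain_cons_cons] at h
    rw [List.map_cons, ih h.2, h.1]
    rfl

theorem map_head_perm_map_tail {c : List (Fin G.numArcs)} (hc : G.IsClosedWalk c) :
    (c.map G.head).Perm (c.map G.tail) := by
  cases c with
  | nil => exact .refl _
  | cons a l =>
    rw [ArcDigraph.IsClosedWalk, Cycle.chain_coe_cons] at hc
    rw [map_eq_of_isChain hc]
    exact (List.perm_append_singleton a l).map _

theorem sum_indicator {c : List (Fin G.numArcs)} (hc : c.Nodup) (f : Fin G.numArcs → Fin G.numNodes)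
    (v : Fin G.numNodes) :
    ∑ e, (if f e = v then indicator c e else 0) = ((c.map f).count v : ℝ) := by
  have h : ∀ e, (if f e = v then indicator c e else 0) =
      if e ∈ c then (if f e = v then (1 : ℝ) else 0) else 0 := by
    intro e; simp only [indicator]; split_ifs <;> rfl
  simp only [h]
  have h' : ∀ e, e ∈ c ↔ e ∈ c.toFinset := by simp
  simp only [h']
  rw [Finset.sum_ite_mem, Finset.univ_inter, List.sum_toFinset _ hc]
  clear hc h h'
  induction c with
  | nil => simp
  | cons a c ih =>
    rw [List.map_cons, List.sum_cons, ih, List.map_cons, List.count_cons]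
    by_cases hv : f a = v <;> simp [hv, add_comm]

theorem isCirculation_indicator {c : List (Fin G.numArcs)} (hc : G.IsClosedWalk c)
    (hn : c.Nodup) : IsCirculation G (indicator c) := by
  intro v
  rw [sum_indicator hn, sum_indicator hn, (map_head_perm_map_tail hc).count_eq]

theorem sum_eq_of_support_subset {c : List (Fin G.numArcs)} {z : Fin G.numArcs → ℝ}
    (hz : ∀ e, z e ≠ 0 → e ∈ c) {f : Fin G.numArcs → Fin G.numNodes} (hf : (c.map f).Nodup)
    {e : Fin G.numArcs} (he : e ∈ c) :
    ∑ e', (if f e' = f e then z e' else 0) = z e := by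
  rw [Finset.sum_eq_single e]
  · simp
  · intro e' _ hne
    split_ifs with h
    · by_contra h0
      exact hne (List.inj_on_of_nodup_map hf (hz e' h0) he h)
    · rfl
  · simp

/-- A circulation that lives on a dicycle is constant there: at each node of the dicycle the inflow
uses a single arc, and so does the outflow. -/
theorem eq_of_support_subset {c : List (Fin G.numArcs)} (hc : G.IsClosedWalk c)
    (hn : (c.map G.tail).Nodup) {z : Fin G.numArcs → ℝ} (hz : IsCirculation G z)
    (hs : ∀ e, z e ≠ 0 → e ∈ c) {e e' : Fin G.numArcs} (he : e ∈ c) (he' : e' ∈ c) :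
    z e = z e' := by
  have hh : (c.map G.head).Nodup := (map_head_perm_map_tail hc).nodup_iff.2 hn
  have key : ∀ e ∈ c, ∀ e' ∈ c, G.head e = G.tail e' → z e = z e' := by
    intro e he e' he' h
    rw [← sum_eq_of_support_subset hs hh he, hz, h, sum_eq_of_support_subset hs hn he']
  have hchain : Cycle.Chain (fun e e' => z e = z e') (c : Cycle (Fin G.numArcs)) := by
    cases c with
    | nil => trivial
    | cons a l =>
      rw [ArcDigraph.IsClosedWalk, Cycle.chain_coe_cons] at hc
      rw [Cycle.chain_coe_cons]
      exact hc.imp_of_mem_imp fun x y hx hy hxy =>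
        key x (by simp at hx ⊢; tauto) y (by simp at hy ⊢; tauto) hxy
  have : IsTrans (Fin G.numArcs) fun e e' => z e = z e' := ⟨fun _ _ _ h h' => h.trans h'⟩
  exact Cycle.chain_iff_pairwise.1 hchain e (by simpa using he) e' (by simpa using he')

theorem exists_mem_periodicPts {α : Type*} [Finite α] (f : α → α) (a : α) :
    ∃ x, x ∈ Function.periodicPts f := by
  obtain ⟨i, j, hij, h⟩ := Finite.exists_ne_map_eq_of_infinite fun n : ℕ => f^[n] a
  wlog hlt : i < j generalizing i j
  · exact this j i hij.symm h.symm (by omega)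
  refine ⟨f^[i] a, j - i, by omega, ?_⟩
  change f^[j - i] (f^[i] a) = f^[i] a
  rw [← Function.iterate_add_apply, Nat.sub_add_cancel hlt.le]
  exact h.symm

/-- A nonzero nonnegative circulation is positive on all arcs of some dicycle. -/
theorem exists_dicycle_of_isCirculation {z : Fin G.numArcs → ℝ} (hz : IsCirculation G z)
    (h0 : ∀ e, 0 ≤ z e) (hne : z ≠ 0) :
    ∃ c : List (Fin G.numArcs), c ≠ [] ∧ G.IsClosedWalk c ∧ (c.map G.tail).Nodup ∧
      ∀ e ∈ c, 0 < z e := by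
  -- The head of a positive arc has positive inflow, hence positive outflow.
  have hnext : ∀ e, 0 < z e → ∃ e', G.tail e' = G.head e ∧ 0 < z e' := by
    intro e he
    by_contra! hno
    have h₁ : ∑ e', (if G.tail e' = G.head e then z e' else 0) ≤ 0 :=
      Finset.sum_nonpos fun e' _ => by split_ifs with h <;> [exact hno e' h; exact le_rfl]
    have h₂ : z e ≤ ∑ e', (if G.head e' = G.head e then z e' else 0) := by
      have := Finset.single_le_sum (f := fun e' => if G.head e' = G.head e then z e' else 0)
        (fun e' _ => by split_ifs <;> [exact h0 e'; exact le_rfl]) (Finset.mem_univ e)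
      simpa using this
    rw [hz] at h₂
    linarith
  let V := {v : Fin G.numNodes // ∃ e, G.tail e = v ∧ 0 < z e}
  let out : V → Fin G.numArcs := fun v => v.2.choose
  have hout : ∀ v : V, G.tail (out v) = v ∧ 0 < z (out v) := fun v => v.2.choose_spec
  -- A periodic orbit of `f` is a dicycle without repeated nodes.
  let f : V → V := fun v => ⟨G.head (out v), hnext _ (hout v).2⟩
  obtain ⟨e₀, he₀⟩ : ∃ e, z e ≠ 0 := Function.ne_iff.1 hne
  obtain ⟨x, hx⟩ := exists_mem_periodicPts f ⟨_, e₀, rfl, (h0 e₀).lt_of_ne' he₀⟩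
  set l := (List.range (Function.minimalPeriod f x)).map fun n => f^[n] x with hl
  have hlo : (l : Cycle V) = Function.periodicOrbit f x := rfl
  refine ⟨l.map out, ?_, ?_, ?_, ?_⟩
  · have := Function.minimalPeriod_pos_of_mem_periodicPts hx
    simp only [hl, ne_eq, List.map_eq_nil_iff, List.range_eq_nil]
    omega
  · rw [ArcDigraph.IsClosedWalk, ← Cycle.map_coe, Cycle.chain_map, hlo,
      Function.periodicOrbit_chain' _ hx]
    intro n
    rw [Function.iterate_succ_apply', (hout _).1]
  · have hnd : l.Nodup := by
      rw [← Cycle.nodup_coe_iff, hlo]; exact Function.nodup_periodicOrbit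
    rw [List.map_map]
    refine hnd.map fun v w h => Subtype.ext ?_
    simpa [(hout _).1] using h
  · intro e he
    obtain ⟨v, -, rfl⟩ := List.mem_map.1 he
    exact (hout v).2

end Circulations

/-! ### The polyhedron of circulations between `0` and `1` -/

section Polytope

variable (G : ArcDigraph)

/-- The cumulative incidence matrix. Its row `i` stands for the set of nodes greater than
`numArcs - 1 - i`, and its product with `z` is the net inflow of `z` into this set. Thresholds
beyond the number of nodes give zero rows. -/
def cutMatrix : Matrix (Fin G.numArcs) (Fin G.numArcs) ℚ := fun i e =>
  (if (i.rev : ℕ) < G.head e then 1 else 0) - (if (i.rev : ℕ) < G.tail e then 1 else 0)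

/-- The matrix of the inequalities `z ≤ 1` and `-z ≤ 0`. -/
def boxMatrix (m : ℕ) : Matrix (Fin (m + m)) (Fin m) ℚ :=
  fun i e => Fin.append (fun j : Fin m => if j = e then (1 : ℚ) else 0)
    (fun j => if j = e then -1 else 0) i

/-- The right-hand side of the inequalities `z ≤ 1` and `-z ≤ 0`. -/
def boxBound (m : ℕ) : Fin (m + m) → ℚ := Fin.append (1 : Fin m → ℚ) (0 : Fin m → ℚ)

/-- The real version of a rational matrix. -/
abbrev realMat {κ μ : Type*} (M : Matrix κ μ ℚ) : Matrix κ μ ℝ := M.map fun q => (q : ℝ)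

theorem boxMatrix_mulVec_castAdd {m : ℕ} (z : Fin m → ℝ) (e : Fin m) :
    (realMat (boxMatrix m)).mulVec z (Fin.castAdd m e) = z e := by
  simp only [Matrix.mulVec, dotProduct, boxMatrix, Matrix.map_apply, Fin.append_left]
  simp [apply_ite (fun q : ℚ => (q : ℝ))]

theorem boxMatrix_mulVec_natAdd {m : ℕ} (z : Fin m → ℝ) (e : Fin m) :
    (realMat (boxMatrix m)).mulVec z (Fin.natAdd m e) = -z e := by
  simp only [Matrix.mulVec, dotProduct, boxMatrix, Matrix.map_apply, Fin.append_right]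
  simp [apply_ite (fun q : ℚ => (q : ℝ))]

theorem forall_fin_add {m n : ℕ} {p : Fin (m + n) → Prop} :
    (∀ i, p i) ↔ (∀ i, p (Fin.castAdd n i)) ∧ ∀ i, p (Fin.natAdd m i) :=
  ⟨fun h => ⟨fun _ => h _, fun _ => h _⟩, fun h i => Fin.addCases h.1 h.2 i⟩

theorem boxMatrix_mulVec_le {m : ℕ} {z : Fin m → ℝ} :
    (realMat (boxMatrix m)).mulVec z ≤ (fun i => (boxBound m i : ℝ)) ↔
      ∀ e, 0 ≤ z e ∧ z e ≤ 1 := by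
  rw [Pi.le_def, forall_fin_add]
  simp only [boxMatrix_mulVec_castAdd, boxMatrix_mulVec_natAdd, boxBound, Fin.append_left,
    Fin.append_right]
  simp [forall_and, and_comm]

theorem support_boxMatrix_mulVec_subset {m : ℕ} {z g : Fin m → ℝ} :
    Function.support ((realMat (boxMatrix m)).mulVec z) ⊆
        Function.support ((realMat (boxMatrix m)).mulVec g) ↔
      ∀ e, z e ≠ 0 → g e ≠ 0 := by
  rw [Function.support_subset_iff, forall_fin_add]
  simp only [Function.mem_support, boxMatrix_mulVec_castAdd, boxMatrix_mulVec_natAdd]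
  simp

theorem signCompatible_boxMatrix {m : ℕ} {u v : Fin m → ℝ} :
    SignCompatible (realMat (boxMatrix m)) u v ↔ ∀ e, 0 ≤ u e * v e := by
  rw [SignCompatible, forall_fin_add]
  simp only [boxMatrix_mulVec_castAdd, boxMatrix_mulVec_natAdd]
  simp

theorem cutMatrix_mulVec (z : Fin G.numArcs → ℝ) (i : Fin G.numArcs) :
    (realMat (cutMatrix G)).mulVec z i =
      ∑ e, (if (i.rev : ℕ) < G.head e then z e else 0) -
        ∑ e, (if (i.rev : ℕ) < G.tail e then z e else 0) := by
  rw [Matrix.mulVec, dotProduct, ← Finset.sum_sub_distrib]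
  refine Finset.sum_congr rfl fun e _ => ?_
  simp only [Matrix.map_apply, cutMatrix]
  split_ifs <;> simp

/-- Sums above a threshold from sums at the single nodes. -/
theorem sum_threshold_eq {m n : ℕ} (f : Fin m → Fin n) (z : Fin m → ℝ) (k : ℕ) :
    ∑ e, (if k < (f e : ℕ) then z e else 0) =
      ∑ v : Fin n, if k < (v : ℕ) then (∑ e, if f e = v then z e else 0) else 0 := by
  have h : ∀ v : Fin n, (if k < (v : ℕ) then (∑ e, if f e = v then z e else 0) else 0) =
      ∑ e, if f e = v then (if k < (f e : ℕ) then z e else 0) else 0 := by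
    intro v
    split_ifs with hv
    · exact Finset.sum_congr rfl fun e _ => by
        split_ifs with h₁ h₂ <;> first | rfl | exact absurd (h₁ ▸ hv) h₂
    · exact (Finset.sum_eq_zero fun e _ => by
        split_ifs with h₁ h₂ <;> first | rfl | exact absurd (h₁ ▸ h₂) hv).symm
  simp only [h]
  rw [Finset.sum_comm]
  simp

/-- Sums at a single node from sums above two thresholds. The node `0` has no threshold below it;
there the sum over all arcs, which does not depend on `f`, takes its place. -/
theorem sum_eq_threshold {m n : ℕ} (f : Fin m → Fin n) (z : Fin m → ℝ) (v : Fin n) :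
    ∑ e, (if f e = v then z e else 0) =
      (if (v : ℕ) = 0 then ∑ e, z e else ∑ e, if (v : ℕ) - 1 < (f e : ℕ) then z e else 0) -
        ∑ e, if (v : ℕ) < (f e : ℕ) then z e else 0 := by
  split_ifs with hv <;> rw [← Finset.sum_sub_distrib] <;>
  · refine Finset.sum_congr rfl fun e _ => ?_
    simp only [Fin.ext_iff]
    split_ifs <;> first | omega | simp

/-- Netting over the sets of nodes above a threshold gives the same circulations as netting at
each node, provided that there are enough thresholds. -/
theorem cutMatrix_mulVec_eq_zero (hG : G.numNodes ≤ G.numArcs) (z : Fin G.numArcs → ℝ) :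
    (realMat (cutMatrix G)).mulVec z = 0 ↔ IsCirculation G z := by
  constructor
  · intro h v
    have hk : ∀ k < G.numNodes, ∑ e, (if k < (G.head e : ℕ) then z e else 0) =
        ∑ e, if k < (G.tail e : ℕ) then z e else 0 := by
      intro k hk
      have := congrFun h (Fin.rev ⟨k, by omega⟩)
      rw [cutMatrix_mulVec, Fin.rev_rev] at this
      exact sub_eq_zero.1 this
    rw [sum_eq_threshold, sum_eq_threshold, hk v v.2, hk (v - 1) (by omega)]
  · intro h
    funext i
    rw [cutMatrix_mulVec, sum_threshold_eq G.head, sum_threshold_eq G.tail, Pi.zero_apply, sub_eq_zero]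
    simp only [h _]

end Polytope

/-! ### Decompositions of the digraph and circuit walks -/

section Reduction

theorem card_le_of_forall_mem {m : ℕ} {l : List (Fin m)} (h : ∀ e, e ∈ l) : m ≤ l.length := by
  have : (Finset.univ : Finset (Fin m)) ⊆ l.toFinset := fun e _ => by simpa using h e
  simpa using (Finset.card_le_card this).trans (List.toFinset_card_le l)

variable (G : TwoRegularEulerianDigraph)

theorem numArcs_eq : G.numArcs = 2 * G.numNodes := by
  have h := Finset.card_eq_sum_card_fiberwise (f := G.tail) (s := Finset.univ)
    (t := Finset.univ) (by simp)
  simp only [G.outDegree] at h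
  simpa [mul_comm] using h

theorem cutMatrix_mulVec_eq_zero_iff (z : Fin G.numArcs → ℝ) :
    (realMat (cutMatrix G.toArcDigraph)).mulVec z = 0 ↔ IsCirculation G.toArcDigraph z :=
  cutMatrix_mulVec_eq_zero _ (by have := numArcs_eq G; omega) z

/-- The polyhedron of the instance: the circulations with values between `0` and `1`. -/
def boxedCirculations : Set (Fin G.numArcs → ℝ) :=
  polyhedron (realMat (cutMatrix G.toArcDigraph)) (fun i => (((0 : Fin G.numArcs → ℚ) i : ℚ) : ℝ))
    (realMat (boxMatrix G.numArcs)) (fun i => (boxBound G.numArcs i : ℝ))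

theorem mem_boxedCirculations {z : Fin G.numArcs → ℝ} :
    z ∈ boxedCirculations G ↔ IsCirculation G.toArcDigraph z ∧ ∀ e, 0 ≤ z e ∧ z e ≤ 1 := by
  rw [← cutMatrix_mulVec_eq_zero_iff, ← boxMatrix_mulVec_le]
  simp [boxedCirculations, polyhedron, Pi.zero_def]

/-- Circulations with values `0` and `1` are vertices, as they are vertices of the box. -/
theorem mem_extremePoints_boxedCirculations {z : Fin G.numArcs → ℝ}
    (hz : IsCirculation G.toArcDigraph z) (h : ∀ e, z e = 0 ∨ z e = 1) :
    z ∈ Set.extremePoints ℝ (boxedCirculations G) := by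
  rw [mem_extremePoints_iff_left]
  refine ⟨(mem_boxedCirculations G).2 ⟨hz, fun e => ?_⟩, ?_⟩
  · rcases h e with h | h <;> simp [h]
  · rintro x hx y hy ⟨a, b, ha, hb, hab, rfl⟩
    funext e
    have hx' := ((mem_boxedCirculations G).1 hx).2 e
    have hy' := ((mem_boxedCirculations G).1 hy).2 e
    simp only [Pi.add_apply, Pi.smul_apply, smul_eq_mul] at h ⊢
    rcases h e with h | h <;> rw [h]
    · nlinarith [mul_nonneg ha.le hx'.1, mul_nonneg hb.le hy'.1]
    · nlinarith [mul_nonneg ha.le (sub_nonneg.2 hx'.2), mul_nonneg hb.le (sub_nonneg.2 hy'.2)]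

theorem isCirculation_zero : IsCirculation G.toArcDigraph 0 := fun v => by simp

theorem isCirculation_one : IsCirculation G.toArcDigraph 1 := fun v => by
  simp [G.inDegree, G.outDegree]

/-- The instance of SCM-Circ-Dist that belongs to `G`: the polyhedron of the circulations with
values between `0` and `1`, its vertices `0` and `1`, and two steps. -/
def instanceOf : SCMCircDistInstance where
  dim := G.numArcs
  numEq := G.numArcs
  numIneq := G.numArcs + G.numArcs
  A := cutMatrix G.toArcDigraph
  b := 0
  B := boxMatrix G.numArcs
  d := boxBound G.numArcs
  x := 0
  y := 1
  k := 2
  x_vertex := mem_extremePoints_boxedCirculations G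
    (by simpa [← Pi.zero_def] using isCirculation_zero G) (fun e => .inl (by simp))
  y_vertex := mem_extremePoints_boxedCirculations G
    (by simpa [← Pi.one_def] using isCirculation_one G) (fun e => .inr (by simp))

/-- The circuits of the instance. -/
abbrev circulationCircuits : Set (Fin G.numArcs → ℝ) :=
  circuits (realMat (cutMatrix G.toArcDigraph)) (realMat (boxMatrix G.numArcs))

variable {G}

/-- The indicator vector of a dicycle is a circuit. -/
theorem indicator_mem_circuits {c : List (Fin G.numArcs)} (hc : G.IsClosedWalk c)
    (hn : (c.map G.tail).Nodup) (hne : c ≠ []) :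
    indicator (G := G.toArcDigraph) c ∈ circulationCircuits G := by
  obtain ⟨a, ha⟩ := List.exists_mem_of_ne_nil c hne
  refine ⟨(cutMatrix_mulVec_eq_zero_iff G _).2 (isCirculation_indicator hc hn.of_map), ?_, ?_,
    fun e => if e ∈ c then 1 else 0, fun e => by simp [indicator], ?_⟩
  · intro h
    simpa [indicator, ha] using congrFun h a
  · intro z hz hz0 hs
    refine hs.antisymm (support_boxMatrix_mulVec_subset.2 fun e he => ?_)
    have he : e ∈ c := by by_contra h; simp [indicator, h] at he
    have hs' : ∀ e, z e ≠ 0 → e ∈ c := fun e he => by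
      have := support_boxMatrix_mulVec_subset.1 hs e he
      by_contra h
      simp [indicator, h] at this
    obtain ⟨e', he'⟩ := Function.ne_iff.1 hz0
    rw [eq_of_support_subset hc hn ((cutMatrix_mulVec_eq_zero_iff G _).1 hz) hs' he (hs' e' he')]
    exact he'
  · rw [← Finset.normalize_gcd, normalize_eq_one]
    refine isUnit_of_dvd_one ?_
    have := Finset.gcd_dvd (f := fun e => if e ∈ c then (1 : ℤ) else 0) (Finset.mem_univ a)
    simpa [ha] using this

/-- A nonnegative circuit is positive exactly on the arcs of some dicycle. -/
theorem exists_dicycle_of_mem_circuits {g : Fin G.numArcs → ℝ} (hg : g ∈ circulationCircuits G)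
    (h0 : ∀ e, 0 ≤ g e) :
    ∃ c : List (Fin G.numArcs), G.IsClosedWalk c ∧ (c.map G.tail).Nodup ∧
      ∀ e, g e ≠ 0 → e ∈ c := by
  obtain ⟨hA, hne, hmin, -⟩ := hg
  obtain ⟨c, hc0, hc, hn, hpos⟩ :=
    exists_dicycle_of_isCirculation ((cutMatrix_mulVec_eq_zero_iff G _).1 hA) h0 hne
  refine ⟨c, hc, hn, fun e he => ?_⟩
  obtain ⟨hA', hne', -⟩ := indicator_mem_circuits hc hn hc0
  have := hmin _ hA' hne' (support_boxMatrix_mulVec_subset.2 fun e he => by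
    refine (hpos e ?_).ne'
    by_contra h
    simp [indicator, h] at he)
  have := support_boxMatrix_mulVec_subset.1 this.ge e he
  by_contra h
  simp [indicator, h] at this

theorem indicator_add_indicator {c₁ c₂ : List (Fin G.numArcs)} (hd : c₁.Disjoint c₂)
    (hall : ∀ e, e ∈ c₁ ∨ e ∈ c₂) :
    indicator (G := G.toArcDigraph) c₁ + indicator (G := G.toArcDigraph) c₂ = 1 := by
  funext e
  have h := @hd e
  have h' := hall e
  by_cases h₁ : e ∈ c₁ <;> by_cases h₂ : e ∈ c₂ <;> simp_all [indicator]

/-- The question for the instance, with the casts of the vectors `0` and `1` carried out. -/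
theorem scmCircDist_instanceOf_iff : SCMCircDist (instanceOf G) ↔
    ∃ W : List ((Fin G.numArcs → ℝ) × ℝ),
      IsCircuitWalk (realMat (cutMatrix G.toArcDigraph))
        (fun i => (((0 : Fin G.numArcs → ℚ) i : ℚ) : ℝ)) (realMat (boxMatrix G.numArcs))
        (fun i => (boxBound G.numArcs i : ℝ)) 0 1 W ∧
      W.length ≤ 2 ∧
      IsSignCompatibleDecomposition (realMat (cutMatrix G.toArcDigraph))
        (realMat (boxMatrix G.numArcs)) 1 W := by
  have hx : (fun i => (((0 : Fin G.numArcs → ℚ) i : ℚ) : ℝ)) = (0 : Fin G.numArcs → ℝ) := by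
    funext i; simp
  have hy : (fun i => (((1 : Fin G.numArcs → ℚ) i : ℚ) : ℝ)) = (1 : Fin G.numArcs → ℝ) := by
    funext i; simp
  have h : SCMCircDist (instanceOf G) ↔
    ∃ W : List ((Fin G.numArcs → ℝ) × ℝ),
      IsCircuitWalk (realMat (cutMatrix G.toArcDigraph))
        (fun i => (((0 : Fin G.numArcs → ℚ) i : ℚ) : ℝ)) (realMat (boxMatrix G.numArcs))
        (fun i => (boxBound G.numArcs i : ℝ)) (fun i => (((0 : Fin G.numArcs → ℚ) i : ℚ) : ℝ))
        (fun i => (((1 : Fin G.numArcs → ℚ) i : ℚ) : ℝ)) W ∧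
      W.length ≤ 2 ∧
      IsSignCompatibleDecomposition (realMat (cutMatrix G.toArcDigraph))
        (realMat (boxMatrix G.numArcs)) ((fun i => (((1 : Fin G.numArcs → ℚ) i : ℚ) : ℝ)) -
          fun i => (((0 : Fin G.numArcs → ℚ) i : ℚ) : ℝ)) W := Iff.rfl
  rw [h, hx, hy, sub_zero]

/-- The two indicator vectors are a walk from `0` to `1`, with steps of length `1`. -/
theorem scmCircDist_of_decomposition
    (h : G.toArcDigraph.HasTwoHamiltonianDicycleDecomposition) : SCMCircDist (instanceOf G) := by
  rw [scmCircDist_instanceOf_iff]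
  obtain ⟨c₁, c₂, ⟨hc₁, hn₁, hall₁⟩, ⟨hc₂, hn₂, hall₂⟩, hd, hall⟩ := h
  have hne : ∀ c : List (Fin G.numArcs), (∀ v, v ∈ c.map G.tail) → c ≠ [] := by
    rintro c hc rfl
    simpa using hc ⟨0, G.numNodes_pos⟩
  have hsum := indicator_add_indicator hd hall
  have hcirc₁ := indicator_mem_circuits hc₁ hn₁ (hne c₁ hall₁)
  have hcirc₂ := indicator_mem_circuits hc₂ hn₂ (hne c₂ hall₂)
  set g₁ : Fin G.numArcs → ℝ := indicator (G := G.toArcDigraph) c₁ with hg₁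
  set g₂ : Fin G.numArcs → ℝ := indicator (G := G.toArcDigraph) c₂ with hg₂
  obtain ⟨a₁, ha₁⟩ := List.exists_mem_of_ne_nil c₁ (hne c₁ hall₁)
  obtain ⟨a₂, ha₂⟩ := List.exists_mem_of_ne_nil c₂ (hne c₂ hall₂)
  refine ⟨[(g₁, 1), (g₂, 1)], ⟨?_, ?_, ?_, ?_, ?_⟩, le_rfl, ⟨?_, ?_, ?_, ?_⟩⟩
  · simpa using ⟨hcirc₁, hcirc₂⟩
  · simp
  · simpa [walkPoint] using hsum
  · intro k hk hk'
    change _ ∈ boxedCirculations G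
    rw [mem_boxedCirculations]
    obtain rfl | rfl : k = 1 ∨ k = 2 := by simp at hk'; omega
    · have : walkPoint 0 [(g₁, (1 : ℝ)), (g₂, 1)] 1 = g₁ := by simp [walkPoint]
      rw [this]
      refine ⟨isCirculation_indicator hc₁ hn₁.of_map, fun e => ?_⟩
      simp only [hg₁, indicator]; split_ifs <;> simp
    · have : walkPoint 0 [(g₁, (1 : ℝ)), (g₂, 1)] 2 = 1 := by simpa [walkPoint] using hsum
      rw [this]
      exact ⟨isCirculation_one G, fun e => by simp⟩
  · intro k hk t ht hmem
    replace hmem := ((mem_boxedCirculations G).1 hmem).2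
    obtain rfl | rfl : k = 0 ∨ k = 1 := by simp at hk; omega
    · have := (hmem a₁).2
      have h' : g₁ a₁ = 1 := by simp [hg₁, indicator, ha₁]
      simp [walkPoint, h'] at this ht
      linarith
    · have := (hmem a₂).2
      have h : 0 ≤ g₁ a₂ := by simp only [hg₁, indicator]; split_ifs <;> simp
      have h' : g₂ a₂ = 1 := by simp [hg₂, indicator, ha₂]
      simp [walkPoint, h'] at this ht
      linarith
  · simpa using ⟨hcirc₁, hcirc₂⟩
  · simp
  · simpa using hsum
  · have h0 : ∀ s ∈ [(g₁, (1 : ℝ)), (g₂, 1)], ∀ e, 0 ≤ s.1 e := by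
      simp only [List.mem_cons, List.not_mem_nil, or_false, forall_eq_or_imp, forall_eq, hg₁, hg₂,
        indicator]
      constructor <;> intro e <;> split_ifs <;> simp
    exact fun s hs s' hs' => signCompatible_boxMatrix.2 fun e => mul_nonneg (h0 s hs e) (h0 s' hs' e)

/-- The steps of a sign-compatible decomposition of `1` are nonnegative. -/
theorem nonneg_of_sum_eq_one {m : ℕ} {W : List ((Fin m → ℝ) × ℝ)} (hpos : ∀ s ∈ W, 0 < s.2)
    (hsum : (W.map fun s : (Fin m → ℝ) × ℝ => s.2 • s.1).sum = 1)
    (hcomp : ∀ s ∈ W, ∀ s' ∈ W, ∀ e, 0 ≤ s.1 e * s'.1 e) : ∀ s ∈ W, ∀ e, 0 ≤ s.1 e := by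
  intro s hs e
  by_contra! hneg
  have h : ((W.map fun s : (Fin m → ℝ) × ℝ => s.2 • s.1).sum) e ≤ 0 := by
    rw [Pi.list_sum_apply, List.map_map]
    refine (List.sum_le_card_nsmul _ 0 ?_).trans (by simp)
    simp only [List.mem_map, Function.comp_apply, Pi.smul_apply, smul_eq_mul,
      forall_exists_index, and_imp, forall_apply_eq_imp_iff₂]
    intro s' hs'
    have := hcomp s hs s' hs' e
    have : s'.1 e ≤ 0 := by nlinarith
    exact mul_nonpos_of_nonneg_of_nonpos (hpos s' hs').le this
  rw [hsum, Pi.one_apply] at h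
  linarith

/-- Two dicycles that cover all `2n` arcs have `n` arcs each, so they are Hamiltonian and disjoint. -/
theorem decomposition_of_scmCircDist (h : SCMCircDist (instanceOf G)) :
    G.toArcDigraph.HasTwoHamiltonianDicycleDecomposition := by
  obtain ⟨W, -, hk, ⟨hcirc, hpos, hsum1, hcomp⟩⟩ := scmCircDist_instanceOf_iff.1 h
  have h0 := nonneg_of_sum_eq_one hpos hsum1 fun s hs s' hs' =>
    signCompatible_boxMatrix.1 (hcomp s hs s' hs')
  have hcyc : ∀ s ∈ W, ∃ c : List (Fin G.numArcs), G.IsClosedWalk c ∧ (c.map G.tail).Nodup ∧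
      ∀ e, s.1 e ≠ 0 → e ∈ c := fun s hs => exists_dicycle_of_mem_circuits (hcirc s hs) (h0 s hs)
  have hcover : ∀ e, ∃ s ∈ W, s.1 e ≠ 0 := by
    intro e
    by_contra! hno
    have := congrFun hsum1 e
    rw [Pi.list_sum_apply, List.map_map, List.sum_eq_zero] at this
    · simp at this
    · simp only [List.mem_map, Function.comp_apply, Pi.smul_apply, smul_eq_mul,
        forall_exists_index, and_imp, forall_apply_eq_imp_iff₂]
      intro s hs
      rw [hno s hs, mul_zero]
  have hm := numArcs_eq G
  have hn := G.numNodes_pos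
  have hlen : ∀ c : List (Fin G.numArcs), (c.map G.tail).Nodup → c.length ≤ G.numNodes := by
    intro c hc
    simpa using hc.length_le_card
  match W, hk with
  | [], _ =>
    obtain ⟨s, hs, -⟩ := hcover ⟨0, by omega⟩
    simp at hs
  | [s], _ =>
    obtain ⟨c, -, hnd, hc⟩ := hcyc s (by simp)
    have := card_le_of_forall_mem (l := c) fun e => by
      obtain ⟨s', hs', he⟩ := hcover e
      obtain rfl : s' = s := by simpa using hs'
      exact hc e he
    have := hlen c hnd
    omega
  | [s, s'], _ =>
    obtain ⟨c, hw, hnd, hc⟩ := hcyc s (by simp)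
    obtain ⟨c', hw', hnd', hc'⟩ := hcyc s' (by simp)
    have hall : ∀ e, e ∈ c ++ c' := by
      intro e
      obtain ⟨s'', hs'', he⟩ := hcover e
      obtain rfl | rfl : s'' = s ∨ s'' = s' := by simpa using hs''
      · exact List.mem_append_left _ (hc e he)
      · exact List.mem_append_right _ (hc' e he)
    have hcard := card_le_of_forall_mem hall
    rw [List.length_append] at hcard
    have h₁ := hlen c hnd
    have h₂ := hlen c' hnd'
    have hfull : ∀ c : List (Fin G.numArcs), (c.map G.tail).Nodup → c.length = G.numNodes →
        ∀ v, v ∈ c.map G.tail := by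
      intro c hc hl v
      have : (c.map G.tail).toFinset = Finset.univ := by
        rw [← Finset.card_eq_iff_eq_univ, List.toFinset_card_of_nodup hc]
        simpa using hl
      simpa using this.ge (Finset.mem_univ v)
    have hdisj : c.Disjoint c' := by
      refine List.disjoint_of_nodup_append ?_
      rw [← Multiset.coe_nodup, ← Multiset.toFinset_card_eq_card_iff_nodup]
      have : ((c ++ c' : List _) : Multiset (Fin G.numArcs)).toFinset = Finset.univ := by
        ext e; simpa using hall e
      rw [this]
      simp
      omega
    exact ⟨c, c', ⟨hw, hnd, hfull c hnd (by omega)⟩, ⟨hw', hnd', hfull c' hnd' (by omega)⟩, hdisj,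
      fun e => List.mem_append.1 (hall e)⟩
  | _ :: _ :: _ :: _, hk => simp at hk

end Reduction

/-! ### The output of the machine is the encoding of the instance -/

/-- The arcs of a digraph as pairs of numbers. -/
def arcPairs (G : ArcDigraph) : List (ℕ × ℕ) :=
  (List.finRange G.numArcs).map fun e => ((G.tail e : ℕ), (G.head e : ℕ))

theorem length_arcPairs (G : ArcDigraph) : (arcPairs G).length = G.numArcs := by simp [arcPairs]

theorem encode_eq_inputWord (G : ArcDigraph) : G.encode = inputWord G.numNodes (arcPairs G) := by
  rw [ArcDigraph.encode, inputWord, arcPairs, List.flatMap_map, List.append_assoc]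
  rfl

theorem encodeRat_zero : encodeRat 0 ++ [.comma] = zeroEntry := rfl
theorem encodeRat_one : encodeRat 1 ++ [.comma] = oneEntry := rfl
theorem encodeRat_neg_one : encodeRat (-1) ++ [.comma] = negEntry := rfl

theorem ofFn_eq_map_range {α : Type*} {m : ℕ} (f : ℕ → α) :
    (List.ofFn fun i : Fin m => f i) = (List.range m).map f := by
  apply List.ext_getElem <;> simp

theorem encodeVec_const (m : ℕ) (q : ℚ) :
    encodeVec (fun _ : Fin m => q) = copies m (encodeRat q ++ [.comma]) := by
  simp [encodeVec, copies, List.flatMap_replicate]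

theorem encodeVec_append {m n : ℕ} (u : Fin m → ℚ) (v : Fin n → ℚ) :
    encodeVec (Fin.append u v) = encodeVec u ++ encodeVec v := by
  rw [encodeVec, List.ofFn_fin_append, List.flatMap_append]; rfl

theorem encodeVec_single {m : ℕ} (i : Fin m) (q : ℚ) :
    encodeVec (fun e : Fin m => if i = e then q else 0) =
      copies i zeroEntry ++ (encodeRat q ++ [.comma]) ++ copies (m - 1 - i) zeroEntry := by
  obtain ⟨i, hi⟩ := i
  obtain ⟨j, rfl⟩ : ∃ j, m = i + (1 + j) := ⟨m - 1 - i, by omega⟩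
  have : (fun e : Fin (i + (1 + j)) => if (⟨i, hi⟩ : Fin (i + (1 + j))) = e then q else 0) =
      Fin.append (fun _ : Fin i => (0 : ℚ)) (Fin.append (fun _ : Fin 1 => q) fun _ : Fin j => 0) := by
    funext e
    refine Fin.addCases (fun a => ?_) (fun a => ?_) e
    · simp [Fin.ext_iff]; omega
    · rw [Fin.append_right]
      refine Fin.addCases (fun b => ?_) (fun b => ?_) a
      · simp [Fin.ext_iff]
      · simp [Fin.ext_iff]
  rw [this, encodeVec_append, encodeVec_append, encodeVec_const, encodeVec_const, encodeVec_const,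
    encodeRat_zero]
  have : i + (1 + j) - 1 - i = j := by omega
  simp [copies, this]

theorem encodeMat_eq_flatMap {m c : ℕ} (M : Matrix (Fin m) (Fin c) ℚ) (w : ℕ → List SCMSymbol)
    (h : ∀ i : Fin m, encodeVec (M i) ++ [.semicolon] = w i) :
    encodeMat M = (List.range m).flatMap w := by
  rw [encodeMat, List.flatMap_def, List.flatMap_def, ← ofFn_eq_map_range, List.map_ofFn]
  congr 2
  funext i
  exact h i

theorem encodeMat_boxMatrix (m : ℕ) :
    encodeMat (boxMatrix m) = diagRows false m m ++ diagRows true m m := by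
  have h : encodeMat (boxMatrix m) =
      encodeMat (fun i j : Fin m => if i = j then (1 : ℚ) else 0) ++
        encodeMat (fun i j : Fin m => if i = j then (-1 : ℚ) else 0) := by
    simp only [encodeMat]
    rw [← List.flatMap_append, ← List.ofFn_fin_append]
    congr 2
    funext i
    refine Fin.addCases (fun a => ?_) (fun a => ?_) i
    · rw [Fin.append_left]
      congr 1
      funext j
      simp only [boxMatrix, Fin.append_left]
    · rw [Fin.append_right]
      congr 1
      funext j
      simp only [boxMatrix, Fin.append_right]
  rw [h, diagRows, diagRows]
  congr 1 <;>
  · refine encodeMat_eq_flatMap _ _ fun i => ?_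
    rw [encodeVec_single, diagEntries]
    rfl

/-- The difference of two truth values is encoded as the entry that the machine writes. -/
theorem encodeRat_diff (p q : Prop) [Decidable p] [Decidable q] :
    encodeRat ((if p then 1 else 0) - (if q then 1 else 0)) ++ [.comma] =
      diffEntry (decide p) (decide q) := by
  by_cases hp : p <;> by_cases hq : q <;> simp only [hp, hq, if_true, if_false] <;>
    norm_num [diffEntry, encodeRat_zero, encodeRat_one, encodeRat_neg_one]

theorem encodeMat_cutMatrix (G : ArcDigraph) :
    encodeMat (cutMatrix G) = incRows G.numArcs (arcPairs G) := by
  refine encodeMat_eq_flatMap _ _ fun i => ?_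
  congr 1
  rw [encodeVec, incEntries, arcPairs, List.flatMap_map, List.ofFn_eq_map, List.flatMap_map]
  refine List.flatMap_congr fun e _ => ?_
  rw [cutMatrix, encodeRat_diff]
  have : (i.rev : ℕ) = G.numArcs - 1 - i := by rw [Fin.val_rev]; omega
  simp only [this]

theorem encode_instanceOf (G : TwoRegularEulerianDigraph) :
    (instanceOf G).encode = outputWord (arcPairs G.toArcDigraph) := by
  have h : (instanceOf G).encode = encodeMat (cutMatrix G.toArcDigraph) ++ [.hash] ++
      encodeVec (fun _ : Fin G.numArcs => 0) ++ [.hash] ++ encodeMat (boxMatrix G.numArcs) ++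
      [.hash] ++ encodeVec (Fin.append (fun _ : Fin G.numArcs => 1) fun _ : Fin G.numArcs => 0) ++
      [.hash] ++ encodeVec (fun _ : Fin G.numArcs => 0) ++ [.hash] ++
      encodeVec (fun _ : Fin G.numArcs => 1) ++ [.hash] ++ encodeNat 2 := rfl
  rw [h, encodeMat_cutMatrix, encodeMat_boxMatrix, encodeVec_append, encodeVec_const,
    encodeVec_const, encodeRat_zero, encodeRat_one, outputWord, length_arcPairs]
  rfl

theorem toCfg_eq_initList (s : List DigraphSymbol) :
    Config.toCfg ⟨some .header, contents s [] [] [], []⟩ = initList machine s := by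
  refine congrArg (TM2.Cfg.mk _ none) ?_
  funext k
  rcases k with _ | _ | _ | _ | _ <;> rfl

theorem toCfg_eq_haltList (o : List SCMSymbol) :
    Config.toCfg ⟨none, contents [] [] [] [], o⟩ = haltList machine o := by
  refine congrArg (TM2.Cfg.mk _ none) ?_
  funext k
  rcases k with _ | _ | _ | _ | _ <;> rfl

theorem computableInPolyTime_instanceOf :
    Nonempty (TM2ComputableInPolyTime
      (fun G : TwoRegularEulerianDigraph => G.toArcDigraph.encode)
      SCMCircDistInstance.encode instanceOf) := by
  refine ⟨{ tm := machine, inputAlphabet := Equiv.refl _, outputAlphabet := Equiv.refl _,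
            time := 6 * Polynomial.X ^ 2 + 50 * Polynomial.X + 50, outputsFun := fun G => ?_ }⟩
  have h := runs_machine G.numNodes (arcPairs G.toArcDigraph)
  rw [← encode_eq_inputWord, ← encode_instanceOf] at h
  have hex := h.exists_iterate
  rw [toCfg_eq_initList, toCfg_eq_haltList] at hex
  have hrun : TM2OutputsInTime machine (G.encode : List DigraphSymbol)
      (some ((instanceOf G).encode : List SCMSymbol))
      (6 * G.encode.length ^ 2 + 50 * G.encode.length + 50) :=
    ⟨⟨hex.choose, hex.choose_spec.2⟩, hex.choose_spec.1⟩
  have htime : (6 * Polynomial.X ^ 2 + 50 * Polynomial.X + 50 : Polynomial ℕ).eval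
      G.encode.length = 6 * G.encode.length ^ 2 + 50 * G.encode.length + 50 := by simp
  exact cast (congr (congrArg₂ (TM2OutputsInTime machine)
    (List.map_id (G.encode : List DigraphSymbol)).symm
    (congrArg some (List.map_id ((instanceOf G).encode : List SCMSymbol)).symm)) htime.symm) hrun

end HamiltonReduction

theorem corollary3 :
    PolyTimeReducible
      (fun G : TwoRegularEulerianDigraph => G.toArcDigraph.encode)
      (fun G : TwoRegularEulerianDigraph => G.toArcDigraph.HasTwoHamiltonianDicycleDecomposition)
      SCMCircDistInstance.encode
      SCMCircDist :=
  ⟨HamiltonReduction.instanceOf, HamiltonReduction.computableInPolyTime_instanceOf, fun _ =>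
    ⟨HamiltonReduction.scmCircDist_of_decomposition,
      HamiltonReduction.decomposition_of_scmCircDist⟩⟩
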